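/- Let $d\ge 2$. A basic cube is a set $\prod_{i=1}^d[n_i,n_i+1)$ with $n\in\mathbb Z^d$. For an even $N\in\mathbb N$ put $Q=[-\frac N2,\frac N2]^d$ and let $\mathcal P$ be the collection of basic cubes contained in $Q$. For a basic cube $I$ put $Q_0(I)=I$ and let $Q_{k+1}(I)$ be the union of all $J\in\mathcal P$ with $\overline J\cap\overline{Q_k(I)}\ne\emptyset$. For a point $x$ let $I(x)$ be the basic cube containing $x$, and let $m_d$ be Lebesgue measure. There are constants $c_0\in(0,1)$ and $N_0\in\mathbb N$, depending only on $d$, and for every $r_0>1$ a constant $\alpha>0$, depending only on $d$ and $r_0$, such that the following holds for every $r_0>1$, every $\varepsilon>0$, every even $N>N_0$ and every collection $\mathcal E\subset\mathcal P$ with $\frac{\#\mathcal E}{\#\mathcal P}\le\varepsilon c_0$. For at least half of the cubes $I\in\mathcal P$ there is a finite sequence of non-negative integers $k_1<k_2<\dots<k_n$ (depending on $I$) such that: 1. for every $1\le j\le n$ and every $x\in\partial Q_{k_j}(I)$ there is an integer $s=s(x)\ge\frac{r_0}2$ with (a) $Q_{s}(I(x))\subset Q_{k_{j+1}}(I)\setminus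 Q_{k_{j-1}}(I)$, where for $j=n$ the set $Q_{k_{n+1}}(I)$ is read as $Q$ and for $j=1$ the set $Q_{k_0}(I)$ is read as $\emptyset$; (b) $\#\{J\in\mathcal E:\ J\subset Q_s(I(x))\}\le\varepsilon\, m_d\big(Q_s(I(x))\big)$; 2. $$n\ \ge\ \alpha\,\frac{N}{1+\left(\frac{\#\mathcal E}{\varepsilon N}\right)^{\frac1{d-1}}}\,\log^{\frac d{d-1}}\left(2+\frac{\#\mathcal E}{\varepsilon N}\right).$$ -/

import Mathlib

open MeasureTheory Set

/-- The basic (half-open unit lattice) cube `∏ᵢ [nᵢ, nᵢ + 1)` with lower corner `n ∈ ℤᵈ`.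
Distinct corners give distinct cubes, so collections of basic cubes are sets of corners. -/
def basicCube {d : ℕ} (n : Fin d → ℤ) : Set (Fin d → ℝ) :=
  {x | ∀ i, (n i : ℝ) ≤ x i ∧ x i < (n i : ℝ) + 1}

/-- The big cube `Q = [-N/2, N/2]ᵈ`. -/
def bigCube (d N : ℕ) : Set (Fin d → ℝ) :=
  {x | ∀ i, -(N : ℝ) / 2 ≤ x i ∧ x i ≤ (N : ℝ) / 2}

/-- The collection `𝒫` of basic cubes contained in `Q = [-N/2, N/2]ᵈ`. -/
def basicCubesIn (d N : ℕ) : Set (Fin d → ℤ) :=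
  {n | basicCube n ⊆ bigCube d N}

/-- The corner of the basic cube `I(x)` containing the point `x`. -/
noncomputable def cubeAt {d : ℕ} (x : Fin d → ℝ) : Fin d → ℤ := fun i => ⌊x i⌋

/-- `Q_j(I)`: the cube formed by `I` and `j` layers of basic cubes of `𝒫` around it,
`Q_0(I) = I` and `Q_{j+1}(I) = ⋃ {J ∈ 𝒫 : closure J ∩ closure Q_j(I) ≠ ∅}`. -/
def layerCube {d : ℕ} (N : ℕ) (I : Fin d → ℤ) : ℕ → Set (Fin d → ℝ)
  | 0 => basicCube I
  | j + 1 => ⋃ J ∈ {J ∈ basicCubesIn d N |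
      (closure (basicCube J) ∩ closure (layerCube N I j)).Nonempty}, basicCube J

/-- The finite strictly increasing sequence `k_1 < ⋯ < k_n` (indexed here by `Fin n`) satisfies:
for each `j` and each `x ∈ ∂Q_{k_j}(I)` there is an integer `s = j(x) ≥ r₀ / 2` such that
* `Q_s(I(x)) ⊆ Q_{k_{j+1}}(I) \ Q_{k_{j-1}}(I)`, where there is no outer constraint other than
  `Q_s(I(x)) ⊆ Q` (automatic, as `s ≥ 1`) for the last `j` and no inner one for the first `j`;
* the number of cubes of `E` inside `Q_s(I(x))` is at most `ε` times the volume of `Q_s(I(x))`. -/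
def IsLayerSequence {d : ℕ} (N : ℕ) (ε r₀ : ℝ) (E : Set (Fin d → ℤ)) (I : Fin d → ℤ)
    (n : ℕ) (k : Fin n → ℕ) : Prop :=
  StrictMono k ∧
  ∀ j : Fin n, ∀ x ∈ frontier (layerCube N I (k j)), ∃ s : ℕ, r₀ / 2 ≤ (s : ℝ) ∧
    (∀ i : Fin n, (i : ℕ) = (j : ℕ) + 1 → layerCube N (cubeAt x) s ⊆ layerCube N I (k i)) ∧
    (∀ i : Fin n, (i : ℕ) + 1 = (j : ℕ) →
      Disjoint (layerCube N (cubeAt x) s) (layerCube N I (k i))) ∧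
    (({J ∈ E | basicCube J ⊆ layerCube N (cubeAt x) s}.ncard : ℕ) : ℝ)
      ≤ ε * (volume (layerCube N (cubeAt x) s)).toReal

/-!
The statement is about the sup-metric on `ℤᵈ`. Membership of a point in a layer cube depends only
on the lattice cube containing the point (`layerCube_eq`), volumes are cardinalities
(`volume_layerCube`), and the cubes containing boundary points of the `k`-th layer cube around `I`
are at distance `k` or `k + 1` from `I` when `I` is far from the boundary of the large cube
(`cubeAt_of_mem_frontier`).

Fix radii `r k = s₀ + λ k` growing slowly with `k`, and call `k` admissible for `I` if around each
cube at distance `k` or `k + 1` from `I` some layer cube of radius between `s₀` and `r k` is sparse.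
Admissible indices whose gaps exceed the radii form a layer sequence
(`isLayerSequence_of_separated`), and a greedy choice yields at least `(1 / 5) ∑ 1 / r k` of them,
the sum running over the admissible `k` (`exists_separated_subset`). So the weight `1 / r k` of the
non-admissible indices must be bounded for most `I`.

By Vitali's covering lemma the dense layer cubes are controlled by disjoint ones, of radii `σ` with
`∑ σᵈ ≤ #E / ε` (`exists_vitali_family`). A cube `I` within `8 σ` of one of these is discarded: there
are few, as `c₀` is small. Otherwise a dense cube of radius `σ` at `y` spoils only indices `k` with
`|dist y I - k| ≤ 4 σ` and `r k ≤ 3 σ`. For given `k` this concerns `O(σ kᵈ⁻¹)` of the cubes `I`, so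
after summation over `k ≤ 3 σ / λ` the weight spoiled by it, totalled over all `I`, is
`O(σᵈ / λᵈ)` (`sum_shadow_le`), and altogether at most `O(λ⁻ᵈ #E / ε)`
(`sum_not_isAdmissible_le`). On the other side the total weight of the indices `k ≤ N / (40 d)` is of
order `λ⁻¹ log (λ N)`, since each dyadic scale contributes equally. With `t = #E / (ε N)` and
`λ = R / N` the two balance if `Rᵈ⁻¹ log R` is a large multiple of `t`, which leads to `critScale`,
and `(N / R) log (2 + t)` is the asserted lower bound. Markov's inequality then gives the claim for
most cubes (`exists_many_layerSequences`). When `N` is bounded in terms of `d` and `r₀`, a single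
index suffices (`exists_layerSequence_one`).
-/

/-! ### Layer cubes in terms of the sup-metric -/

/-- The corners of the basic cubes contained in `[-M, M]ᵈ`, as a finite set. -/
noncomputable def latticeBox (d M : ℕ) : Finset (Fin d → ℤ) :=
  Fintype.piFinset fun _ => Finset.Ico (-(M : ℤ)) M

/-- The corners in `latticeBox d M` at sup-distance at most `s` from `J`. -/
noncomputable def boxBall {d : ℕ} (M : ℕ) (J : Fin d → ℤ) (s : ℕ) : Finset (Fin d → ℤ) :=
  {J' ∈ latticeBox d M | dist J' J ≤ s}

theorem mem_latticeBox {d M : ℕ} {J : Fin d → ℤ} :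
    J ∈ latticeBox d M ↔ ∀ i, -(M : ℤ) ≤ J i ∧ J i < M := by
  simp [latticeBox]

theorem card_latticeBox (d M : ℕ) : (latticeBox d M).card = (M + M) ^ d := by
  rw [latticeBox, Fintype.card_piFinset]
  simp only [Int.card_Ico, Finset.prod_const, Finset.card_univ, Fintype.card_fin]
  congr 1
  omega

theorem dist_le_natCast_iff {d : ℕ} {J I : Fin d → ℤ} {s : ℕ} :
    dist J I ≤ s ↔ ∀ i, |J i - I i| ≤ (s : ℤ) := by
  rw [dist_pi_le_iff (Nat.cast_nonneg s)]
  refine forall_congr' fun i => ?_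
  rw [Int.dist_eq]
  exact_mod_cast Iff.rfl

theorem mem_boxBall {d M : ℕ} {J J' : Fin d → ℤ} {s : ℕ} :
    J' ∈ boxBall M J s ↔ J' ∈ latticeBox d M ∧ dist J' J ≤ s := by
  simp [boxBall]

theorem basicCube_eq_pi {d : ℕ} (n : Fin d → ℤ) :
    basicCube n = Set.univ.pi fun i => Set.Ico (n i : ℝ) (n i + 1) := by
  ext x; simp [basicCube]

theorem mem_basicCube_iff {d : ℕ} {n : Fin d → ℤ} {x : Fin d → ℝ} :
    x ∈ basicCube n ↔ cubeAt x = n := by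
  simp only [basicCube, cubeAt, mem_ofPred_eq, funext_iff, Int.floor_eq_iff]

theorem mem_closure_basicCube {d : ℕ} {n : Fin d → ℤ} {x : Fin d → ℝ} :
    x ∈ closure (basicCube n) ↔ ∀ i, (n i : ℝ) ≤ x i ∧ x i ≤ n i + 1 := by
  have h : ∀ i, closure (Set.Ico (n i : ℝ) (n i + 1)) = Set.Icc (n i : ℝ) (n i + 1) :=
    fun i => closure_Ico (by simp)
  rw [basicCube_eq_pi, closure_pi_set]
  simp [h, Pi.le_def, forall_and]

theorem basicCubesIn_eq (d M : ℕ) : basicCubesIn d (M + M) = latticeBox d M := by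
  ext n
  rw [Finset.mem_coe, mem_latticeBox]
  have hM : ∀ x : Fin d → ℝ, x ∈ bigCube d (M + M) ↔ ∀ i, -(M : ℝ) ≤ x i ∧ x i ≤ M := by
    intro x
    have h1 : -((M + M : ℕ) : ℝ) / 2 = -M := by push_cast; ring
    have h2 : ((M + M : ℕ) : ℝ) / 2 = M := by push_cast; ring
    rw [bigCube, mem_ofPred_eq, h1, h2]
  constructor
  · intro h i
    have hcl : IsClosed (bigCube d (M + M)) := by
      have : bigCube d (M + M) = Set.univ.pi fun _ => Set.Icc (-(M : ℝ)) M := by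
        ext x; rw [hM]; simp [Pi.le_def, forall_and]
      rw [this]
      exact isClosed_set_pi fun _ _ => isClosed_Icc
    have h' : closure (basicCube n) ⊆ bigCube d (M + M) := closure_minimal h hcl
    have h0 := (hM _).1 (h' (mem_closure_basicCube.2
      (show ∀ i, (n i : ℝ) ≤ (n i : ℝ) ∧ (n i : ℝ) ≤ n i + 1 from fun i => by simp))) i
    have h1 := (hM _).1 (h' (mem_closure_basicCube.2
      (show ∀ i, (n i : ℝ) ≤ (n i : ℝ) + 1 ∧ (n i : ℝ) + 1 ≤ n i + 1 from fun i => by simp))) i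
    refine ⟨by exact_mod_cast h0.1, ?_⟩
    have : n i + 1 ≤ (M : ℤ) := by exact_mod_cast h1.2
    omega
  · intro h x hx
    rw [hM]
    intro i
    have h1 : (-(M : ℝ)) ≤ n i := by exact_mod_cast (h i).1
    have h2 : (n i : ℝ) + 1 ≤ M := by exact_mod_cast (h i).2
    exact ⟨h1.trans (hx i).1, (hx i).2.le.trans h2⟩

theorem closure_basicCube_inter_nonempty_iff {d : ℕ} {J J' : Fin d → ℤ} :
    (closure (basicCube J) ∩ closure (basicCube J')).Nonempty ↔ ∀ i, |J i - J' i| ≤ 1 := by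
  constructor
  · rintro ⟨x, hx, hx'⟩ i
    have h1 := mem_closure_basicCube.1 hx i
    have h2 := mem_closure_basicCube.1 hx' i
    have h3 : (J i : ℝ) ≤ J' i + 1 := h1.1.trans h2.2
    have h4 : (J' i : ℝ) ≤ J i + 1 := h2.1.trans h1.2
    have h3' : J i ≤ J' i + 1 := by exact_mod_cast h3
    have h4' : J' i ≤ J i + 1 := by exact_mod_cast h4
    rw [abs_le]; omega
  · intro h
    refine ⟨fun i => max (J i : ℝ) (J' i), mem_closure_basicCube.2 fun i => ?_,
      mem_closure_basicCube.2 fun i => ?_⟩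
    all_goals
      have h1 := abs_le.1 (h i)
      have h3 : (J i : ℝ) ≤ J' i + 1 := by exact_mod_cast (by omega : J i ≤ J' i + 1)
      have h4 : (J' i : ℝ) ≤ J i + 1 := by exact_mod_cast (by omega : J' i ≤ J i + 1)
    · exact ⟨le_max_left _ _, max_le (by linarith) h4⟩
    · exact ⟨le_max_right _ _, max_le h3 (by linarith)⟩

/-- The `j`-th layer around a cube of `𝒫` consists of the cubes of `𝒫` at sup-distance at most
`j`, so membership of a point depends only on the cube containing it. -/
theorem layerCube_eq {d M : ℕ} {I : Fin d → ℤ} (hI : I ∈ latticeBox d M) (j : ℕ) :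
    layerCube (M + M) I j = cubeAt ⁻¹' (boxBall M I j : Set (Fin d → ℤ)) := by
  induction j with
  | zero =>
    ext x
    rw [layerCube, mem_basicCube_iff, mem_preimage, Finset.mem_coe, mem_boxBall]
    constructor
    · rintro h
      simp [h, hI]
    · rintro ⟨-, h⟩
      exact dist_le_zero.1 (by simpa using h)
  | succ j ih =>
    have hU : layerCube (M + M) I j = ⋃ J ∈ boxBall M I j, basicCube J := by
      rw [ih]; ext x; simp [mem_basicCube_iff]
    have hcl : closure (layerCube (M + M) I j) = ⋃ J ∈ boxBall M I j, closure (basicCube J) := by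
      rw [hU, (boxBall M I j).closure_biUnion]
    ext x
    simp only [layerCube, mem_iUnion, mem_preimage, Finset.mem_coe, mem_boxBall, mem_ofPred_eq,
      exists_prop, mem_basicCube_iff]
    have key : ∀ J ∈ latticeBox d M,
        ((closure (basicCube J) ∩ closure (layerCube (M + M) I j)).Nonempty ↔
          dist J I ≤ (j + 1 : ℕ)) := by
      intro J hJ
      rw [hcl, dist_le_natCast_iff]
      constructor
      · rintro ⟨x, hx, hx'⟩ i
        simp only [mem_iUnion, exists_prop] at hx'
        obtain ⟨J', hJ', hx'⟩ := hx'
        have h1 := closure_basicCube_inter_nonempty_iff.1 ⟨x, hx, hx'⟩ i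
        have h2 := dist_le_natCast_iff.1 (mem_boxBall.1 hJ').2 i
        rw [abs_le] at *
        push_cast
        omega
      · intro h
        -- move each coordinate of `J` one step towards `I`
        let J' : Fin d → ℤ := fun i =>
          if I i < J i then J i - 1 else if J i < I i then J i + 1 else J i
        have hJ' : J' ∈ boxBall M I j := by
          rw [mem_boxBall, mem_latticeBox, dist_le_natCast_iff]
          rw [mem_latticeBox] at hI hJ
          refine ⟨fun i => ?_, fun i => ?_⟩
          · have := hI i
            have := hJ i
            simp only [J']
            split_ifs <;> omega
          · have := abs_le.1 (h i)
            push_cast at this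
            rw [abs_le]
            simp only [J']
            split_ifs <;> omega
        have hJJ' : ∀ i, |J i - J' i| ≤ 1 := by
          intro i
          rw [abs_le]
          simp only [J']
          split_ifs <;> omega
        obtain ⟨x, hx, hx'⟩ := closure_basicCube_inter_nonempty_iff.2 hJJ'
        exact ⟨x, hx, by simp only [mem_iUnion]; exact ⟨J', hJ', hx'⟩⟩
    rw [basicCubesIn_eq]
    constructor
    · rintro ⟨J, ⟨hJ, h⟩, hx⟩
      rw [hx]
      exact ⟨hJ, (key J hJ).1 h⟩
    · rintro ⟨hJ, h⟩
      exact ⟨_, ⟨hJ, (key _ hJ).2 h⟩, rfl⟩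

theorem corner_mem_basicCube {d : ℕ} (J : Fin d → ℤ) :
    (fun i => (J i : ℝ)) ∈ basicCube J := fun i => by simp

theorem basicCube_subset_layerCube_iff {d M : ℕ} {I J : Fin d → ℤ} (hI : I ∈ latticeBox d M)
    {s : ℕ} : basicCube J ⊆ layerCube (M + M) I s ↔ J ∈ boxBall M I s := by
  rw [layerCube_eq hI]
  constructor
  · intro h
    have := h (corner_mem_basicCube J)
    rwa [mem_preimage, mem_basicCube_iff.1 (corner_mem_basicCube J)] at this
  · intro h x hx
    rwa [mem_preimage, mem_basicCube_iff.1 hx]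

theorem volume_layerCube {d M : ℕ} {I : Fin d → ℤ} (hI : I ∈ latticeBox d M) (s : ℕ) :
    (volume (layerCube (M + M) I s)).toReal = (boxBall M I s).card := by
  have hU : layerCube (M + M) I s = ⋃ J ∈ boxBall M I s, basicCube J := by
    rw [layerCube_eq hI]; ext x; simp [mem_basicCube_iff]
  have h1 : ∀ J : Fin d → ℤ, volume (basicCube J) = 1 := by
    intro J
    rw [basicCube_eq_pi, Real.volume_pi_Ico]
    simp
  rw [hU, measure_biUnion_finset]
  · simp [h1]
  · intro J _ J' _ hne
    refine Set.disjoint_left.2 fun x hx hx' => hne ?_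
    rw [← mem_basicCube_iff.1 hx, mem_basicCube_iff.1 hx']
  · intro J _
    rw [basicCube_eq_pi]
    exact MeasurableSet.univ_pi fun _ => measurableSet_Ico

/-- If `k + 1` layers fit around `I`, then the cube containing a boundary point of the `k`-th
layer cube lies in `𝒫`, at sup-distance `k` or `k + 1` from `I`. -/
theorem cubeAt_of_mem_frontier {d M : ℕ} {I : Fin d → ℤ} {k : ℕ}
    (hI : ∀ i, -(M : ℤ) + (k + 1) ≤ I i ∧ I i + (k + 1) < M) {x : Fin d → ℝ}
    (hx : x ∈ frontier (layerCube (M + M) I k)) :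
    cubeAt x ∈ latticeBox d M ∧ (k : ℝ) ≤ dist (cubeAt x) I ∧ dist (cubeAt x) I ≤ k + 1 := by
  have hIbox : I ∈ latticeBox d M := mem_latticeBox.2 fun i => by have := hI i; omega
  have hpi : layerCube (M + M) I k =
      Set.univ.pi fun i => Set.Ico ((I i : ℝ) - k) (I i + k + 1) := by
    rw [layerCube_eq hIbox]
    ext y
    simp only [mem_preimage, Finset.mem_coe, mem_boxBall, mem_latticeBox, dist_le_natCast_iff,
      mem_pi, mem_univ, true_implies, mem_Ico]
    have e : ∀ i, ((I i : ℝ) - k ≤ y i ∧ y i < I i + k + 1) ↔ |cubeAt y i - I i| ≤ k := by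
      intro i
      have e1 : (I i : ℝ) - k ≤ y i ↔ I i - k ≤ ⌊y i⌋ := by
        rw [Int.le_floor]; push_cast; rfl
      have e2 : y i < I i + k + 1 ↔ ⌊y i⌋ < I i + k + 1 := by
        rw [Int.floor_lt]; push_cast; rfl
      rw [e1, e2, abs_le, cubeAt]
      omega
    simp only [e]
    refine ⟨fun h => h.2, fun h => ⟨fun i => ?_, h⟩⟩
    have := abs_le.1 (h i)
    have := hI i
    omega
  have hlt : ∀ i, (I i : ℝ) - k < I i + k + 1 := fun i => by
    have : (0 : ℝ) ≤ k := Nat.cast_nonneg k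
    linarith
  rw [hpi, frontier, closure_pi_set, interior_pi_set Set.finite_univ] at hx
  simp only [closure_Ico (hlt _).ne, interior_Ico, mem_sdiff, mem_pi, mem_univ, true_implies,
    mem_Icc, mem_Ioo, not_forall] at hx
  obtain ⟨hx1, i, hi⟩ := hx
  have hlo : ∀ i, I i - k ≤ cubeAt x i := fun i => by
    rw [cubeAt, Int.le_floor]; push_cast; exact (hx1 i).1
  have hhi : ∀ i, cubeAt x i ≤ I i + k + 1 := fun i => by
    have : (⌊x i⌋ : ℝ) ≤ I i + k + 1 := (Int.floor_le _).trans (hx1 i).2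
    rw [cubeAt]; exact_mod_cast this
  refine ⟨mem_latticeBox.2 fun i => ?_, ?_, ?_⟩
  · have := hI i; have := hlo i; have := hhi i; omega
  · have hk : (k : ℤ) ≤ |cubeAt x i - I i| := by
      by_cases h : x i = I i - k
      · have : cubeAt x i = I i - k := by
          rw [cubeAt, h]; exact_mod_cast Int.floor_intCast (R := ℝ) (I i - k)
        rw [this]; simp
      · have h' : x i = I i + k + 1 := by
          by_contra h'
          exact hi ⟨lt_of_le_of_ne (hx1 i).1 (Ne.symm h), lt_of_le_of_ne (hx1 i).2 h'⟩
        have : cubeAt x i = I i + k + 1 := by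
          rw [cubeAt, h']; exact_mod_cast Int.floor_intCast (R := ℝ) (I i + k + 1)
        rw [this, le_abs]; omega
    refine le_trans ?_ (dist_le_pi_dist _ _ i)
    rw [Int.dist_eq]; exact_mod_cast hk
  · have : dist (cubeAt x) I ≤ ((k + 1 : ℕ) : ℝ) := dist_le_natCast_iff.2 fun i => by
      have := hlo i; have := hhi i
      rw [abs_le]; push_cast; omega
    simpa using this

theorem pow_le_card_boxBall {d M : ℕ} {J : Fin d → ℤ} (hJ : J ∈ latticeBox d M) {s : ℕ}
    (hs : s ≤ M + M) : s ^ d ≤ (boxBall M J s).card := by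
  rw [mem_latticeBox] at hJ
  have hsub : (Fintype.piFinset fun i => Finset.Icc (max (-(M : ℤ)) (J i - s))
      (min ((M : ℤ) - 1) (J i + s))) ⊆ boxBall M J s := by
    intro J' h
    rw [Fintype.mem_piFinset] at h
    rw [mem_boxBall, mem_latticeBox, dist_le_natCast_iff]
    refine ⟨fun i => ?_, fun i => ?_⟩
    all_goals
      have := h i
      simp only [Finset.mem_Icc, max_le_iff, le_min_iff] at this
    · omega
    · rw [abs_le]; omega
  refine le_trans ?_ (Finset.card_le_card hsub)
  rw [Fintype.card_piFinset]
  calc s ^ d = ∏ _i : Fin d, s := by simp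
    _ ≤ _ := Finset.prod_le_prod' fun i _ => by
      have := hJ i
      rw [Int.card_Icc]
      rcases max_cases (-(M : ℤ)) (J i - s) with h | h <;>
        rcases min_cases ((M : ℤ) - 1) (J i + s) with h' | h' <;> omega

theorem boxBall_eq_latticeBox {d M : ℕ} {J : Fin d → ℤ} (hJ : J ∈ latticeBox d M) {s : ℕ}
    (hs : M + M ≤ s) : boxBall M J s = latticeBox d M := by
  ext J'
  rw [mem_boxBall, and_iff_left_iff_imp]
  intro hJ'
  rw [dist_le_natCast_iff]
  intro i
  have := mem_latticeBox.1 hJ i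
  have := mem_latticeBox.1 hJ' i
  rw [abs_le]; omega

/-! ### Admissible indices -/

/-- `E` is sparse in the `s`-th layer cube around `J`: it meets at most `ε` times its cubes. -/
def IsSparseAt {d : ℕ} (M : ℕ) (ε : ℝ) (E : Finset (Fin d → ℤ)) (J : Fin d → ℤ) (s : ℕ) : Prop :=
  ((E ∩ boxBall M J s).card : ℝ) ≤ ε * (boxBall M J s).card

/-- `k` is admissible for `I`: around each cube at sup-distance `k` or `k + 1` from `I` some layer
cube of radius between `s₀` and `r k` is sparse. -/
def IsAdmissible {d : ℕ} (M : ℕ) (ε : ℝ) (E : Finset (Fin d → ℤ)) (s₀ : ℕ) (r : ℕ → ℝ)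
    (I : Fin d → ℤ) (k : ℕ) : Prop :=
  ∀ J ∈ latticeBox d M, (k : ℝ) ≤ dist J I → dist J I ≤ k + 1 →
    ∃ s : ℕ, s₀ ≤ s ∧ (s : ℝ) ≤ r k ∧ IsSparseAt M ε E J s

/-- Admissible indices whose gaps exceed the radii allowed at them form a layer sequence. -/
theorem isLayerSequence_of_separated {d M K s₀ : ℕ} {ε r₀ : ℝ} {E : Finset (Fin d → ℤ)}
    {r : ℕ → ℝ} (hr : Monotone r) (hs₀ : r₀ / 2 ≤ s₀)
    {I : Fin d → ℤ} (hI : ∀ i, -(M : ℤ) + (K + 1) ≤ I i ∧ I i + (K + 1) < M)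
    {S : Finset ℕ} (hSK : ∀ k ∈ S, k ≤ K) (hS : ∀ k ∈ S, IsAdmissible M ε E s₀ r I k)
    (hsep : ∀ a ∈ S, ∀ b ∈ S, a < b → (a : ℝ) + 1 + r b ≤ b) :
    ∃ k : Fin S.card → ℕ, IsLayerSequence (M + M) ε r₀ (E : Set (Fin d → ℤ)) I S.card k := by
  have hIbox : I ∈ latticeBox d M := mem_latticeBox.2 fun i => by have := hI i; omega
  obtain ⟨k, hmono, hmem⟩ : ∃ k : Fin S.card → ℕ, StrictMono k ∧ ∀ j, k j ∈ S :=
    ⟨_, (S.orderEmbOfFin rfl).strictMono, fun j => S.orderEmbOfFin_mem rfl j⟩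
  refine ⟨k, hmono, fun j x hx => ?_⟩
  obtain ⟨hJ, hd1, hd2⟩ := cubeAt_of_mem_frontier (k := k j)
    (fun i => by have := hI i; have := hSK _ (hmem j); omega) hx
  obtain ⟨s, hs1, hs2, hs3⟩ := hS _ (hmem j) _ hJ hd1 hd2
  refine ⟨s, hs₀.trans (by exact_mod_cast hs1), fun i hi => ?_, fun i hi => ?_, ?_⟩
  · have hji : k j < k i := hmono (Fin.lt_def.2 (by omega))
    have h1 := hsep _ (hmem j) _ (hmem i) hji
    have h2 := hr hji.le
    rw [layerCube_eq hJ, layerCube_eq hIbox]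
    refine preimage_mono fun J' hJ' => ?_
    rw [Finset.mem_coe, mem_boxBall] at hJ' ⊢
    refine ⟨hJ'.1, ?_⟩
    linarith [dist_triangle J' (cubeAt x) I]
  · have hij : k i < k j := hmono (Fin.lt_def.2 (by omega))
    have h1 := hsep _ (hmem i) _ (hmem j) hij
    rw [layerCube_eq hJ, layerCube_eq hIbox]
    refine Set.disjoint_left.2 fun y hy hy' => ?_
    rw [mem_preimage, Finset.mem_coe, mem_boxBall] at hy hy'
    linarith [dist_triangle (cubeAt x) (cubeAt y) I, dist_comm (cubeAt x) (cubeAt y)]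
  · rw [volume_layerCube hJ]
    have : {J ∈ (E : Set (Fin d → ℤ)) | basicCube J ⊆ layerCube (M + M) (cubeAt x) s} =
        ((E ∩ boxBall M (cubeAt x) s : Finset _) : Set (Fin d → ℤ)) := by
      ext J
      simp [basicCube_subset_layerCube_iff hJ]
    rw [this, Set.ncard_coe_finset]
    exact hs3

/-! ### Selection of separated indices -/

/-- Greedy selection: a finite set of indices contains a subset with gaps larger than the slowly
growing function `s₀ + λ k`, whose size controls the sum of the reciprocals. -/
theorem exists_separated_subset {s₀ lam : ℝ} (hs : 1 ≤ s₀) (hl : 0 ≤ lam) (hl' : lam ≤ 1 / 2)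
    (G : Finset ℕ) :
    ∃ S ⊆ G, (∀ a ∈ S, ∀ b ∈ S, a < b → (a : ℝ) + 1 + (s₀ + lam * b) ≤ b) ∧
      ∑ k ∈ G, (s₀ + lam * k)⁻¹ ≤ 5 * S.card := by
  induction G using Finset.strongInduction with
  | H G ih =>
    rcases G.eq_empty_or_nonempty with rfl | hG
    · exact ⟨∅, by simp⟩
    set m := G.min' hG with hm
    have hmG : m ∈ G := G.min'_mem hG
    set p : ℕ → Prop := fun k => (m : ℝ) + 1 + (s₀ + lam * k) ≤ k with hp
    classical
    have hmp : ¬ p m := by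
      simp only [hp, not_le]
      have : 0 ≤ lam * (m : ℝ) := by positivity
      linarith
    obtain ⟨S, hSG, hsep, hsum⟩ := ih (G.filter p)
      (Finset.filter_ssubset.2 ⟨m, hmG, hmp⟩)
    have hSp : ∀ k ∈ S, k ∈ G ∧ p k := fun k hk => Finset.mem_filter.1 (hSG hk)
    have hmS : m ∉ S := fun h => hmp (hSp m h).2
    have hrm : 0 < s₀ + lam * (m : ℝ) := by positivity
    refine ⟨insert m S, ?_, ?_, ?_⟩
    · exact Finset.insert_subset hmG fun k hk => (hSp k hk).1
    · intro a ha b hb hab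
      rcases Finset.mem_insert.1 hb with rfl | hb
      · -- nothing in `insert m S` lies below the minimum `m`
        exfalso
        rcases Finset.mem_insert.1 ha with h | ha
        · omega
        · exact absurd (G.min'_le a (hSp a ha).1) (by omega)
      · rcases Finset.mem_insert.1 ha with rfl | ha
        · exact (hSp b hb).2
        · exact hsep a ha b hb hab
    · rw [Finset.card_insert_of_notMem hmS, ← Finset.sum_filter_add_sum_filter_not G p]
      have hrest : ∑ k ∈ G with ¬ p k, (s₀ + lam * (k : ℝ))⁻¹ ≤ 5 := by
        -- the skipped indices lie in a window of length `4 (s₀ + λ m)` after `m`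
        have hsub : (G.filter fun k => ¬ p k) ⊆
            Finset.Icc m (m + ⌊4 * (s₀ + lam * (m : ℝ))⌋₊) := by
          intro k hk
          obtain ⟨hkG, hk⟩ := Finset.mem_filter.1 hk
          have hmk : m ≤ k := G.min'_le k hkG
          have hmk' : (m : ℝ) ≤ k := by exact_mod_cast hmk
          simp only [hp, not_le] at hk
          have h0 : 0 ≤ lam * (m : ℝ) := by positivity
          have h1 : lam * ((k : ℝ) - m) ≤ 1 / 2 * (k - m) :=
            mul_le_mul_of_nonneg_right hl' (by linarith)
          have h2 : ((k - m : ℕ) : ℝ) ≤ 4 * (s₀ + lam * (m : ℝ)) := by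
            rw [Nat.cast_sub hmk]; nlinarith
          have h3 := Nat.le_floor h2
          rw [Finset.mem_Icc]; omega
        have hcard : ((G.filter fun k => ¬ p k).card : ℝ) ≤ 5 * (s₀ + lam * (m : ℝ)) := by
          have h1 : ((G.filter fun k => ¬ p k).card : ℝ) ≤
              ((⌊4 * (s₀ + lam * (m : ℝ))⌋₊ + 1 : ℕ) : ℝ) := by
            have := Finset.card_le_card hsub
            rw [Nat.card_Icc] at this
            exact_mod_cast this.trans (by omega)
          have h2 := Nat.floor_le (show 0 ≤ 4 * (s₀ + lam * (m : ℝ)) by positivity)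
          have h0 : 0 ≤ lam * (m : ℝ) := by positivity
          push_cast at h1
          linarith
        calc _ ≤ ∑ k ∈ G with ¬ p k, (s₀ + lam * (m : ℝ))⁻¹ := by
              refine Finset.sum_le_sum fun k hk => inv_anti₀ hrm ?_
              have : (m : ℝ) ≤ k := by exact_mod_cast G.min'_le k (Finset.mem_filter.1 hk).1
              gcongr
          _ = ((G.filter fun k => ¬ p k).card : ℝ) * (s₀ + lam * (m : ℝ))⁻¹ := by simp
          _ ≤ 5 * (s₀ + lam * (m : ℝ)) * (s₀ + lam * (m : ℝ))⁻¹ := by gcongr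
          _ = 5 := by field_simp
      push_cast
      linarith

/-! ### Covering the dense layer cubes -/

/-- Vitali covering for the layer cubes in which `E` is dense: disjoint ones `(y, σ)`, whose
volumes are charged to disjoint parts of `E`, dominate all the others. -/
theorem exists_vitali_family {d M s₀ : ℕ} {ε : ℝ} (hε : 0 < ε) {E : Finset (Fin d → ℤ)}
    (hE : E ⊆ latticeBox d M) (hEc : (E.card : ℝ) ≤ ε * ((M + M : ℕ) : ℝ) ^ d) :
    ∃ u : Finset ((Fin d → ℤ) × ℕ),
      (∀ p ∈ u, p.1 ∈ latticeBox d M ∧ s₀ ≤ p.2) ∧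
      ∑ p ∈ u, (p.2 : ℝ) ^ d ≤ E.card / ε ∧
      ∀ J ∈ latticeBox d M, ∀ s, s₀ ≤ s → ¬ IsSparseAt M ε E J s →
        ∃ p ∈ u, s ≤ 2 * p.2 ∧ dist J p.1 ≤ s + p.2 := by
  classical
  have hlt : ∀ J ∈ latticeBox d M, ∀ s, ¬ IsSparseAt M ε E J s → s < M + M := by
    intro J hJ s hs
    by_contra h
    apply hs
    rw [IsSparseAt, boxBall_eq_latticeBox hJ (by omega), Finset.inter_eq_left.2 hE,
      card_latticeBox]
    exact_mod_cast hEc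
  let t : Set ((Fin d → ℤ) × ℕ) :=
    {p | p.1 ∈ latticeBox d M ∧ s₀ ≤ p.2 ∧ ¬ IsSparseAt M ε E p.1 p.2}
  have htfin : t.Finite := by
    refine (Finset.finite_toSet (latticeBox d M ×ˢ Finset.range (M + M))).subset ?_
    rintro ⟨J, s⟩ ⟨h1, h2, h3⟩
    simpa [h1] using hlt J h1 s h3
  obtain ⟨u, hut, hdisj, hcov⟩ := Vitali.exists_disjoint_subfamily_covering_enlargement
    (fun p : (Fin d → ℤ) × ℕ => (boxBall M p.1 p.2 : Set (Fin d → ℤ))) t (fun p => (p.2 : ℝ)) 2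
    (by norm_num) (fun _ _ => Nat.cast_nonneg _) ((M + M : ℕ) : ℝ)
    (fun p hp => by exact_mod_cast (hlt _ hp.1 _ hp.2.2).le)
    (fun p hp => ⟨p.1, by simp [mem_boxBall, hp.1]⟩)
  have hufin : u.Finite := htfin.subset hut
  refine ⟨hufin.toFinset, ?_, ?_, ?_⟩
  · intro p hp
    have := hut (hufin.mem_toFinset.1 hp)
    exact ⟨this.1, this.2.1⟩
  · rw [le_div_iff₀ hε, Finset.sum_mul]
    calc ∑ p ∈ hufin.toFinset, (p.2 : ℝ) ^ d * ε
        ≤ ∑ p ∈ hufin.toFinset, ((E ∩ boxBall M p.1 p.2).card : ℝ) := by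
          refine Finset.sum_le_sum fun p hp => ?_
          obtain ⟨h1, -, h3⟩ := hut (hufin.mem_toFinset.1 hp)
          have h4 : ((p.2 : ℝ)) ^ d ≤ (boxBall M p.1 p.2).card := by
            exact_mod_cast pow_le_card_boxBall h1 (hlt _ h1 _ h3).le
          rw [IsSparseAt, not_le] at h3
          nlinarith
      _ = ((hufin.toFinset.biUnion fun p => E ∩ boxBall M p.1 p.2).card : ℝ) := by
          rw [Finset.card_biUnion]
          · push_cast; rfl
          · intro p hp q hq hpq
            have := hdisj (hufin.mem_toFinset.1 hp) (hufin.mem_toFinset.1 hq) hpq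
            exact (Finset.disjoint_coe.1 this).mono Finset.inter_subset_right
              Finset.inter_subset_right
      _ ≤ E.card := by
          exact_mod_cast Finset.card_le_card
            (Finset.biUnion_subset.2 fun _ _ => Finset.inter_subset_left)
  · intro J hJ s hs hns
    obtain ⟨p, hp, ⟨x, hx1, hx2⟩, hle⟩ := hcov (J, s) ⟨hJ, hs, hns⟩
    refine ⟨p, hufin.mem_toFinset.2 hp, by exact_mod_cast hle, ?_⟩
    have h1 := (mem_boxBall.1 (Finset.mem_coe.1 hx1)).2
    have h2 := (mem_boxBall.1 (Finset.mem_coe.1 hx2)).2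
    exact (dist_triangle_left J p.1 x).trans (add_le_add h1 h2)

/-- A non-admissible index lies in the shadow, seen from `I`, of a member of a Vitali family. -/
theorem exists_shadow_of_not_isAdmissible {d M s₀ : ℕ} (hs₀ : 1 ≤ s₀) {ε : ℝ}
    {E : Finset (Fin d → ℤ)} {u : Finset ((Fin d → ℤ) × ℕ)} (hu : ∀ p ∈ u, s₀ ≤ p.2)
    (hcov : ∀ J ∈ latticeBox d M, ∀ s, s₀ ≤ s → ¬ IsSparseAt M ε E J s →
        ∃ p ∈ u, s ≤ 2 * p.2 ∧ dist J p.1 ≤ s + p.2)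
    {r : ℕ → ℝ} (hr : ∀ k, (s₀ : ℝ) ≤ r k) {I : Fin d → ℤ} {k : ℕ}
    (hk : ¬ IsAdmissible M ε E s₀ r I k) :
    ∃ p ∈ u, r k ≤ 3 * p.2 ∧ |dist p.1 I - k| ≤ 4 * p.2 := by
  simp only [IsAdmissible, not_forall, not_exists, not_and, exists_prop] at hk
  obtain ⟨J, hJ, h1, h2, h3⟩ := hk
  have hr0 : 0 ≤ r k := (Nat.cast_nonneg s₀).trans (hr k)
  have hs : s₀ ≤ ⌊r k⌋₊ := Nat.le_floor (hr k)
  obtain ⟨p, hp, hp1, hp2⟩ := hcov J hJ ⌊r k⌋₊ hs (h3 _ hs (Nat.floor_le hr0))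
  have hp1' : (⌊r k⌋₊ : ℝ) ≤ 2 * p.2 := by exact_mod_cast hp1
  have hp3 : (1 : ℝ) ≤ p.2 := by exact_mod_cast hs₀.trans (hu p hp)
  refine ⟨p, hp, by linarith [Nat.lt_floor_add_one (r k)], ?_⟩
  have h4 := abs_le.1 (abs_dist_sub_le p.1 J I)
  rw [dist_comm] at hp2
  rw [abs_le]
  constructor <;> linarith [h4.1, h4.2]

/-! ### Lattice point counts -/

/-- Cubes with `dist y I` in `[k - 4σ, k + 4σ]` lie in `d` pairs of slabs of thickness `8σ + 1`. -/
theorem card_shell_le {d : ℕ} (B : Finset (Fin d → ℤ)) (y : Fin d → ℤ) {k σ : ℕ} (hσ : 1 ≤ σ)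
    (hk : 4 * σ < k) :
    ((B.filter fun I => |dist y I - k| ≤ 4 * (σ : ℝ)).card : ℝ) ≤
      d * (18 * σ * (5 * k) ^ (d - 1)) := by
  classical
  let slab : Finset ℤ :=
    Finset.Icc (-(k + 4 * σ : ℤ)) (-(k - 4 * σ)) ∪ Finset.Icc (k - 4 * σ : ℤ) (k + 4 * σ)
  let side : Finset ℤ := Finset.Icc (-(k + 4 * σ : ℤ)) (k + 4 * σ)
  let F : Fin d → Finset (Fin d → ℤ) := fun i =>
    Fintype.piFinset fun j => ((if j = i then slab else side).image fun z => z + y j)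
  have hsub : (B.filter fun I => |dist y I - k| ≤ 4 * (σ : ℝ)) ⊆ Finset.univ.biUnion F := by
    intro I hI
    obtain ⟨-, hI⟩ := Finset.mem_filter.1 hI
    rw [abs_le] at hI
    have hup : ∀ i, |I i - y i| ≤ ((k + 4 * σ : ℕ) : ℤ) := by
      rw [← dist_le_natCast_iff, dist_comm]
      push_cast; linarith [hI.2]
    obtain ⟨i, hi⟩ : ∃ i, (k : ℤ) - 4 * σ ≤ |I i - y i| := by
      by_contra! hcon
      have h1 : dist I y ≤ ((k - 4 * σ - 1 : ℕ) : ℝ) := dist_le_natCast_iff.2 fun i => by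
        have := hcon i
        omega
      have h2 : ((k - 4 * σ - 1 : ℕ) : ℝ) = k - 4 * σ - 1 := by
        rw [Nat.cast_sub (by omega), Nat.cast_sub (by omega)]; push_cast; ring
      rw [dist_comm, h2] at h1
      linarith [hI.1]
    refine Finset.mem_biUnion.2 ⟨i, Finset.mem_univ _, Fintype.mem_piFinset.2 fun j => ?_⟩
    refine Finset.mem_image.2 ⟨I j - y j, ?_, by ring⟩
    have hj := abs_le.1 (hup j)
    push_cast at hj
    split_ifs with h
    · subst h
      simp only [slab, Finset.mem_union, Finset.mem_Icc]
      rcases le_abs.1 hi with h | h <;> omega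
    · simp only [side, Finset.mem_Icc]
      omega
  have hslab : slab.card ≤ 18 * σ := by
    refine (Finset.card_union_le _ _).trans ?_
    rw [Int.card_Icc, Int.card_Icc]
    omega
  have hside : side.card ≤ 5 * k := by
    rw [Int.card_Icc]
    omega
  have hF : ∀ i, (F i).card ≤ 18 * σ * (5 * k) ^ (d - 1) := by
    intro i
    rw [Fintype.card_piFinset]
    calc ∏ j, ((if j = i then slab else side).image fun z => z + y j).card
        ≤ ∏ j, (if j = i then 18 * σ else 5 * k) := by
          refine Finset.prod_le_prod' fun j _ => Finset.card_image_le.trans ?_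
          split_ifs
          · exact hslab
          · exact hside
      _ = _ := by
          rw [Finset.prod_ite, Finset.prod_const, Finset.prod_const, Finset.filter_eq',
            Finset.filter_ne']
          simp
  have := calc (B.filter fun I => |dist y I - k| ≤ 4 * (σ : ℝ)).card
        ≤ ∑ i, (F i).card := (Finset.card_le_card hsub).trans Finset.card_biUnion_le
      _ ≤ ∑ _i : Fin d, 18 * σ * (5 * k) ^ (d - 1) := Finset.sum_le_sum fun i _ => hF i
      _ = d * (18 * σ * (5 * k) ^ (d - 1)) := by simp
  exact_mod_cast this

theorem card_filter_dist_le {d : ℕ} (B : Finset (Fin d → ℤ)) (y : Fin d → ℤ) (s : ℕ) :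
    (B.filter fun I => dist y I ≤ s).card ≤ (2 * s + 1) ^ d := by
  have hsub : (B.filter fun I => dist y I ≤ s) ⊆
      Fintype.piFinset fun i => Finset.Icc (y i - s) (y i + s) := by
    intro I hI
    have := dist_le_natCast_iff.1 (Finset.mem_filter.1 hI).2
    refine Fintype.mem_piFinset.2 fun i => ?_
    have := abs_le.1 (this i)
    rw [Finset.mem_Icc]; omega
  refine (Finset.card_le_card hsub).trans (le_of_eq ?_)
  rw [Fintype.card_piFinset]
  simp only [Int.card_Icc]
  rw [Finset.prod_congr rfl (g := fun _ => 2 * s + 1) (fun i _ => by omega)]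
  simp

/-! ### The weight of the non-admissible indices -/

theorem sum_pow_div_self_le {d : ℕ} (hd : 2 ≤ d) (K : ℕ) {X : ℝ} (hX : 0 ≤ X) :
    ∑ k ∈ Finset.Icc 1 K with ((k : ℕ) : ℝ) ≤ X, ((k : ℝ))⁻¹ * (k : ℝ) ^ (d - 1) ≤ X ^ (d - 1) := by
  obtain ⟨e, rfl⟩ : ∃ e, d = e + 2 := ⟨d - 2, by omega⟩
  have hsub : ((Finset.Icc 1 K).filter fun k : ℕ => (k : ℝ) ≤ X) ⊆ Finset.Icc 1 ⌊X⌋₊ := by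
    intro k hk
    simp only [Finset.mem_filter, Finset.mem_Icc] at hk ⊢
    exact ⟨hk.1.1, Nat.le_floor hk.2⟩
  have hcard : (((Finset.Icc 1 K).filter fun k : ℕ => (k : ℝ) ≤ X).card : ℝ) ≤ X := by
    have h := Finset.card_le_card hsub
    rw [Nat.card_Icc, Nat.add_sub_cancel] at h
    exact (Nat.cast_le.2 h).trans (Nat.floor_le hX)
  calc _ ≤ ∑ k ∈ Finset.Icc 1 K with ((k : ℕ) : ℝ) ≤ X, X ^ e := by
        refine Finset.sum_le_sum fun k hk => ?_
        simp only [Finset.mem_filter, Finset.mem_Icc] at hk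
        have hk0 : (k : ℝ) ≠ 0 := by
          have := hk.1.1
          positivity
        rw [show e + 2 - 1 = e + 1 by omega, pow_succ, mul_comm, mul_assoc, mul_inv_cancel₀ hk0,
          mul_one]
        exact pow_le_pow_left₀ (Nat.cast_nonneg k) hk.2 e
    _ = (((Finset.Icc 1 K).filter fun k : ℕ => (k : ℝ) ≤ X).card : ℝ) * X ^ e := by simp
    _ ≤ X * X ^ e := by gcongr
    _ = X ^ (e + 2 - 1) := by rw [show e + 2 - 1 = e + 1 by omega]; ring

/-- Total weight, over the indices `k`, of the pairs `(I, k)` shadowed by one cube of radius `σ`: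
the shells of cubes grow like `k ^ (d - 1)`, and only `k ≤ 3σ / λ` count. -/
theorem sum_shadow_le {d : ℕ} (hd : 2 ≤ d) (B : Finset (Fin d → ℤ)) (y : Fin d → ℤ) (K : ℕ)
    {σ : ℕ} (hσ : 1 ≤ σ) {s₀ lam : ℝ} (hs₀ : 0 ≤ s₀) (hl : 0 < lam) :
    ∑ k ∈ Finset.Icc 1 K with (4 * σ < k ∧ lam * ((k : ℕ) : ℝ) ≤ 3 * σ),
      (s₀ + lam * k)⁻¹ * ((B.filter fun I => |dist y I - k| ≤ 4 * (σ : ℝ)).card : ℝ) ≤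
      18 * d * 15 ^ (d - 1) / lam ^ d * (σ : ℝ) ^ d := by
  have hX : (0 : ℝ) ≤ 3 * σ / lam := by positivity
  calc _ ≤ ∑ k ∈ Finset.Icc 1 K with (4 * σ < k ∧ lam * ((k : ℕ) : ℝ) ≤ 3 * σ),
        (18 * d * σ * 5 ^ (d - 1) / lam) * ((k : ℝ)⁻¹ * (k : ℝ) ^ (d - 1)) := by
        refine Finset.sum_le_sum fun k hk => ?_
        simp only [Finset.mem_filter, Finset.mem_Icc] at hk
        have hk0 : (0 : ℝ) < k := by exact_mod_cast hk.1.1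
        calc _ ≤ (lam * k)⁻¹ * (d * (18 * σ * (5 * k) ^ (d - 1))) := by
              gcongr
              · linarith
              · exact card_shell_le B y hσ hk.2.1
          _ = _ := by
              rw [mul_pow]; field_simp
    _ ≤ ∑ k ∈ Finset.Icc 1 K with ((k : ℕ) : ℝ) ≤ 3 * σ / lam,
        (18 * d * σ * 5 ^ (d - 1) / lam) * ((k : ℝ)⁻¹ * (k : ℝ) ^ (d - 1)) := by
        refine Finset.sum_le_sum_of_subset_of_nonneg ?_ fun k _ _ => by positivity
        intro k hk
        simp only [Finset.mem_filter] at hk ⊢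
        refine ⟨hk.1, ?_⟩
        rw [le_div_iff₀ hl]; linarith [hk.2.2]
    _ ≤ (18 * d * σ * 5 ^ (d - 1) / lam) * (3 * σ / lam) ^ (d - 1) := by
        rw [← Finset.mul_sum]
        gcongr
        exact sum_pow_div_self_le hd K hX
    _ = _ := by
        obtain ⟨e, rfl⟩ : ∃ e, d = e + 1 := ⟨d - 1, by omega⟩
        rw [Nat.add_sub_cancel, div_pow, mul_pow, show (15 : ℝ) = 5 * 3 by norm_num, mul_pow]
        field_simp
        ring

open Classical in
/-- The mass of non-admissible indices, summed over all `I` outside the enlarged cubes of the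
Vitali family. -/
theorem sum_not_isAdmissible_le {d M s₀ : ℕ} (hd : 2 ≤ d) (hs₀ : 1 ≤ s₀) {ε lam : ℝ}
    (hl : 0 < lam) {E : Finset (Fin d → ℤ)} {u : Finset ((Fin d → ℤ) × ℕ)}
    (hu : ∀ p ∈ u, s₀ ≤ p.2)
    (hcov : ∀ J ∈ latticeBox d M, ∀ s, s₀ ≤ s → ¬ IsSparseAt M ε E J s →
        ∃ p ∈ u, s ≤ 2 * p.2 ∧ dist J p.1 ≤ s + p.2)
    {B : Finset (Fin d → ℤ)} (hB : ∀ I ∈ B, ∀ p ∈ u, 8 * (p.2 : ℝ) < dist p.1 I) (K : ℕ) :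
    ∑ I ∈ B, ∑ k ∈ Finset.Icc 1 K with
        ¬ IsAdmissible M ε E s₀ (fun k => (s₀ : ℝ) + lam * k) I k, ((s₀ : ℝ) + lam * k)⁻¹ ≤
      18 * d * 15 ^ (d - 1) / lam ^ d * ∑ p ∈ u, (p.2 : ℝ) ^ d := by
  have hr : ∀ k : ℕ, (s₀ : ℝ) ≤ s₀ + lam * k := fun k => by
    have : 0 ≤ lam * (k : ℝ) := by positivity
    linarith
  have hpos : ∀ k : ℕ, 0 ≤ ((s₀ : ℝ) + lam * k)⁻¹ := fun k => by positivity
  set q : (Fin d → ℤ) × ℕ → ℕ → Prop := fun p k => 4 * p.2 < k ∧ lam * (k : ℝ) ≤ 3 * p.2 with hq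
  have hI : ∀ I ∈ B, ∑ k ∈ Finset.Icc 1 K with
        ¬ IsAdmissible M ε E s₀ (fun k => (s₀ : ℝ) + lam * k) I k, ((s₀ : ℝ) + lam * k)⁻¹ ≤
      ∑ p ∈ u, ∑ k ∈ Finset.Icc 1 K with q p k,
        if |dist p.1 I - k| ≤ 4 * (p.2 : ℝ) then ((s₀ : ℝ) + lam * k)⁻¹ else 0 := by
    intro I hIB
    simp only [Finset.sum_filter]
    rw [Finset.sum_comm]
    refine Finset.sum_le_sum fun k _ => ?_
    have hnn : ∀ p ∈ u, 0 ≤ (if q p k then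
        if |dist p.1 I - k| ≤ 4 * (p.2 : ℝ) then ((s₀ : ℝ) + lam * k)⁻¹ else 0 else 0) := by
      intro p _
      split_ifs <;> first | exact hpos k | exact le_rfl
    by_cases h : IsAdmissible M ε E s₀ (fun k => (s₀ : ℝ) + lam * k) I k
    · rw [if_neg (not_not.2 h)]
      exact Finset.sum_nonneg hnn
    · rw [if_pos h]
      obtain ⟨p, hp, h1, h2⟩ := exists_shadow_of_not_isAdmissible hs₀ hu hcov hr h
      have hqk : q p k := by
        have h3 := hB I hIB p hp
        refine ⟨?_, by linarith [(Nat.cast_nonneg s₀ : (0 : ℝ) ≤ s₀)]⟩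
        have : ((4 * p.2 : ℕ) : ℝ) < k := by
          push_cast; linarith [(abs_le.1 h2).2]
        exact_mod_cast this
      refine le_trans ?_ (Finset.single_le_sum hnn hp)
      rw [if_pos hqk, if_pos h2]
  refine (Finset.sum_le_sum hI).trans ?_
  rw [Finset.sum_comm, Finset.mul_sum]
  refine Finset.sum_le_sum fun p hp => ?_
  rw [Finset.sum_comm]
  refine le_trans (le_of_eq ?_)
    (sum_shadow_le hd B p.1 K (hs₀.trans (hu p hp)) (Nat.cast_nonneg s₀) hl)
  refine Finset.sum_congr rfl fun k _ => ?_
  rw [← Finset.sum_filter, Finset.sum_const, nsmul_eq_mul, mul_comm]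

/-! ### Averaging over the cubes -/

/-- The cubes around which `K + 1` layers fit into `[-M, M]ᵈ`. -/
noncomputable def centralBox (d M K : ℕ) : Finset (Fin d → ℤ) :=
  Fintype.piFinset fun _ => Finset.Ico (-(M : ℤ) + (K + 1)) (M - (K + 1))

theorem mem_centralBox {d M K : ℕ} {I : Fin d → ℤ} :
    I ∈ centralBox d M K ↔ ∀ i, -(M : ℤ) + (K + 1) ≤ I i ∧ I i + (K + 1) < M := by
  simp only [centralBox, Fintype.mem_piFinset, Finset.mem_Ico, lt_sub_iff_add_lt]

theorem centralBox_subset (d M K : ℕ) : centralBox d M K ⊆ latticeBox d M := by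
  intro I hI
  rw [mem_centralBox] at hI
  exact mem_latticeBox.2 fun i => by have := hI i; omega

theorem le_card_centralBox {d M K : ℕ} (hd : 1 ≤ d) (hK : 10 * d * (2 * K + 2) ≤ M + M) :
    9 / 10 * ((M + M : ℕ) : ℝ) ^ d ≤ (centralBox d M K).card := by
  have hle : 2 * K + 2 ≤ M + M := by nlinarith
  have hN : (0 : ℝ) < ((M + M : ℕ) : ℝ) := by exact_mod_cast (by omega : 0 < M + M)
  have hcard : (centralBox d M K).card = (M + M - (2 * K + 2)) ^ d := by
    rw [centralBox, Fintype.card_piFinset]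
    simp only [Int.card_Ico, Finset.prod_const, Finset.card_univ, Fintype.card_fin]
    congr 1
    omega
  rw [hcard]
  push_cast [Nat.cast_sub hle]
  push_cast at hN
  set N : ℝ := (M : ℝ) + M
  have hKr : 10 * (d : ℝ) * (2 * K + 2) ≤ N := by
    have : ((10 * d * (2 * K + 2) : ℕ) : ℝ) ≤ ((M + M : ℕ) : ℝ) := by exact_mod_cast hK
    push_cast at this; exact this
  have hleR : (2 * (K : ℝ) + 2) ≤ N := by
    have : ((2 * K + 2 : ℕ) : ℝ) ≤ ((M + M : ℕ) : ℝ) := by exact_mod_cast hle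
    push_cast at this; exact this
  have hb := one_add_mul_le_pow (a := -((2 * (K : ℝ) + 2) / N)) (by
    have : (2 * (K : ℝ) + 2) / N ≤ 1 := (div_le_one hN).2 hleR
    linarith) d
  have h1 : (d : ℝ) * ((2 * K + 2) / N) ≤ 1 / 10 := by
    rw [← mul_div_assoc, div_le_iff₀ hN]; linarith
  calc 9 / 10 * N ^ d ≤ (1 + -((2 * (K : ℝ) + 2) / N)) ^ d * N ^ d := by
        gcongr
        linarith
    _ = _ := by
        rw [← mul_pow]
        congr 1
        field_simp
        ring

open Classical in
/-- For at least half of the cubes, the separated admissible indices number at least a tenth of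
the total weight. -/
theorem exists_many_layerSequences {d M s₀ K : ℕ} (hd : 2 ≤ d) (hs₀ : 1 ≤ s₀) {ε lam r₀ T : ℝ}
    (hε : 0 < ε) (hr₀ : r₀ / 2 ≤ s₀) (hl : 0 < lam) (hl' : lam ≤ 1 / 2)
    (hK : 10 * d * (2 * K + 2) ≤ M + M)
    {E : Finset (Fin d → ℤ)} (hE : E ⊆ latticeBox d M)
    (hEc : 10 * 17 ^ d * (E.card / ε) ≤ ((M + M : ℕ) : ℝ) ^ d)
    (hT0 : 0 < T) (hT : T ≤ ∑ k ∈ Finset.Icc 1 K, ((s₀ : ℝ) + lam * k)⁻¹)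
    (hbad : 20 * (18 * d * 15 ^ (d - 1) / lam ^ d * (E.card / ε)) ≤
      T * ((M + M : ℕ) : ℝ) ^ d) :
    ((M + M : ℕ) : ℝ) ^ d / 2 ≤ (((latticeBox d M).filter fun I => ∃ (n : ℕ) (k : Fin n → ℕ),
      IsLayerSequence (M + M) ε r₀ (E : Set (Fin d → ℤ)) I n k ∧ T / 10 ≤ n).card : ℝ) := by
  set N : ℝ := ((M + M : ℕ) : ℝ) with hN
  have hN0 : 0 ≤ N := Nat.cast_nonneg _
  have hEε : (E.card : ℝ) ≤ ε * N ^ d := by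
    have h0 : 0 ≤ (E.card : ℝ) / ε := by positivity
    have h1 : (1 : ℝ) ≤ 10 * 17 ^ d := by
      have : (1 : ℝ) ≤ 17 ^ d := one_le_pow₀ (by norm_num)
      linarith
    have : (E.card : ℝ) / ε ≤ N ^ d := by nlinarith
    rwa [div_le_iff₀ hε, mul_comm] at this
  obtain ⟨u, hu, hsum, hcov⟩ := exists_vitali_family (s₀ := s₀) hε hE hEε
  set r : ℕ → ℝ := fun k => (s₀ : ℝ) + lam * k with hr
  set far : Finset (Fin d → ℤ) :=
    (centralBox d M K).filter fun I => ∀ p ∈ u, 8 * (p.2 : ℝ) < dist p.1 I with hfar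
  set w : (Fin d → ℤ) → ℝ := fun I =>
    ∑ k ∈ Finset.Icc 1 K with ¬ IsAdmissible M ε E s₀ r I k, (r k)⁻¹ with hw
  have hbadsum : ∑ I ∈ far, w I ≤ T * N ^ d / 20 := by
    refine (sum_not_isAdmissible_le hd hs₀ hl (fun p hp => (hu p hp).2) hcov
      (fun I hI => (Finset.mem_filter.1 hI).2) K).trans ?_
    have : 18 * (d : ℝ) * 15 ^ (d - 1) / lam ^ d * ∑ p ∈ u, (p.2 : ℝ) ^ d ≤
        18 * (d : ℝ) * 15 ^ (d - 1) / lam ^ d * (E.card / ε) := by gcongr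
    linarith
  -- Markov's inequality for the weight of the non-admissible indices
  have hmarkov : ((far.filter fun I => T / 2 < w I).card : ℝ) ≤ N ^ d / 10 := by
    have h1 : ((far.filter fun I => T / 2 < w I).card : ℝ) * (T / 2) ≤ T * N ^ d / 20 := by
      refine le_trans ?_ hbadsum
      calc _ = ∑ I ∈ far with T / 2 < w I, T / 2 := by simp
        _ ≤ ∑ I ∈ far with T / 2 < w I, w I :=
          Finset.sum_le_sum fun I hI => (Finset.mem_filter.1 hI).2.le
        _ ≤ _ := Finset.sum_le_sum_of_subset_of_nonneg (Finset.filter_subset _ _) fun I _ _ =>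
          Finset.sum_nonneg fun k _ => by positivity
    have h2 : ((far.filter fun I => T / 2 < w I).card : ℝ) * (T / 2) ≤ N ^ d / 10 * (T / 2) := by
      linarith
    exact le_of_mul_le_mul_right h2 (by positivity)
  have hnear : (((centralBox d M K).filter fun I =>
      ¬ ∀ p ∈ u, 8 * (p.2 : ℝ) < dist p.1 I).card : ℝ) ≤ N ^ d / 10 := by
    have hsub : ((centralBox d M K).filter fun I => ¬ ∀ p ∈ u, 8 * (p.2 : ℝ) < dist p.1 I) ⊆
        u.biUnion fun p => (centralBox d M K).filter fun I => dist p.1 I ≤ ((8 * p.2 : ℕ) : ℝ) := by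
      intro I hI
      obtain ⟨h1, h2⟩ := Finset.mem_filter.1 hI
      push Not at h2
      obtain ⟨p, hp, h2⟩ := h2
      exact Finset.mem_biUnion.2 ⟨p, hp, Finset.mem_filter.2 ⟨h1, by push_cast; exact h2⟩⟩
    have h1 := (Finset.card_le_card hsub).trans Finset.card_biUnion_le
    have h2 : (((centralBox d M K).filter fun I =>
        ¬ ∀ p ∈ u, 8 * (p.2 : ℝ) < dist p.1 I).card : ℝ) ≤ ∑ p ∈ u, 17 ^ d * (p.2 : ℝ) ^ d := by
      refine (Nat.cast_le.2 h1).trans ?_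
      push_cast
      refine Finset.sum_le_sum fun p hp => ?_
      have h3 := card_filter_dist_le (centralBox d M K) p.1 (8 * p.2)
      have h4 : (2 * (8 * p.2) + 1) ^ d ≤ (17 * p.2) ^ d :=
        Nat.pow_le_pow_left (by have := (hu p hp).2; omega) d
      rw [← mul_pow]
      exact_mod_cast h3.trans h4
    rw [← Finset.mul_sum] at h2
    have h3 : (17 : ℝ) ^ d * ∑ p ∈ u, (p.2 : ℝ) ^ d ≤ 17 ^ d * (E.card / ε) := by gcongr
    linarith
  have hcentral := le_card_centralBox (by omega) hK
  have hsplit1 := Finset.card_filter_add_card_filter_not (s := centralBox d M K)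
    (fun I => ∀ p ∈ u, 8 * (p.2 : ℝ) < dist p.1 I)
  have hsplit2 := Finset.card_filter_add_card_filter_not (s := far) (fun I => T / 2 < w I)
  rw [← hfar] at hsplit1
  have hsplit1' := congrArg (Nat.cast : ℕ → ℝ) hsplit1
  have hsplit2' := congrArg (Nat.cast : ℕ → ℝ) hsplit2
  rw [Nat.cast_add] at hsplit1' hsplit2'
  have hgood : (far.filter fun I => ¬ T / 2 < w I) ⊆
      (latticeBox d M).filter fun I => ∃ (n : ℕ) (k : Fin n → ℕ),
        IsLayerSequence (M + M) ε r₀ (E : Set (Fin d → ℤ)) I n k ∧ T / 10 ≤ n := by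
    intro I hI
    obtain ⟨hI1, hI2⟩ := Finset.mem_filter.1 hI
    have hIc := (Finset.mem_filter.1 hI1).1
    refine Finset.mem_filter.2 ⟨centralBox_subset d M K hIc, ?_⟩
    obtain ⟨S, hSG, hsep, hS⟩ := exists_separated_subset (s₀ := (s₀ : ℝ))
      (by exact_mod_cast hs₀) hl.le hl'
      ((Finset.Icc 1 K).filter fun k => IsAdmissible M ε E s₀ r I k)
    have hSmem := fun (k : ℕ) (hk : k ∈ S) => Finset.mem_filter.1 (hSG hk)
    obtain ⟨k, hk⟩ := isLayerSequence_of_separated (r := r)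
      (fun a b hab => by
        have : (a : ℝ) ≤ b := by exact_mod_cast hab
        simp only [hr]; gcongr)
      hr₀ (mem_centralBox.1 hIc) (fun k hk => (Finset.mem_Icc.1 (hSmem k hk).1).2)
      (fun k hk => (hSmem k hk).2) hsep
    refine ⟨S.card, k, hk, ?_⟩
    have := Finset.sum_filter_add_sum_filter_not (Finset.Icc 1 K)
      (fun k => IsAdmissible M ε E s₀ r I k) (fun k => (r k)⁻¹)
    have hwI : w I ≤ T / 2 := not_lt.1 hI2
    simp only [hw] at hwI
    simp only [hr] at this hwI hS hT
    linarith
  have hfin : ((far.filter fun I => ¬ T / 2 < w I).card : ℝ) ≤ _ :=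
    Nat.cast_le.2 (Finset.card_le_card hgood)
  have : 0 ≤ N ^ d := by positivity
  linarith

/-! ### The critical scale -/

theorem log_div_le_sum_inv {s₀ lam : ℝ} (hs₀ : 0 < s₀) (hl : 0 < lam) (K : ℕ) :
    Real.log ((s₀ + lam * (K + 1)) / (s₀ + lam)) / lam ≤
      ∑ k ∈ Finset.Icc 1 K, (s₀ + lam * k)⁻¹ := by
  have h1 : 0 < s₀ + lam := by positivity
  induction K with
  | zero => simp [h1.ne']
  | succ K ih =>
    rw [Finset.sum_Icc_succ_top (by omega)]
    push_cast at ih ⊢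
    have ha : 0 < s₀ + lam * ((K : ℝ) + 1) := by positivity
    have hb : 0 < s₀ + lam * ((K : ℝ) + 1 + 1) := by positivity
    have hstep : Real.log ((s₀ + lam * ((K : ℝ) + 1 + 1)) / (s₀ + lam * (K + 1))) ≤
        lam * (s₀ + lam * ((K : ℝ) + 1))⁻¹ := by
      refine (Real.log_le_sub_one_of_pos (div_pos hb ha)).trans (le_of_eq ?_)
      field_simp
      ring
    rw [Real.log_div hb.ne' ha.ne'] at hstep
    rw [Real.log_div ha.ne' h1.ne', div_le_iff₀ hl] at ih
    rw [Real.log_div hb.ne' h1.ne', div_le_iff₀ hl]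
    linarith

theorem log_le_half {x : ℝ} (hx : 0 < x) : Real.log x ≤ x / 2 := by
  have h := Real.log_le_sub_one_of_pos (show 0 < x / 2 by positivity)
  rw [Real.log_div hx.ne' (by norm_num)] at h
  linarith [Real.log_two_lt_d9]

theorem half_le_log_two_add {t : ℝ} (ht : 0 ≤ t) : 1 / 2 ≤ Real.log (2 + t) := by
  have : Real.log 2 ≤ Real.log (2 + t) := Real.log_le_log (by norm_num) (by linarith)
  linarith [Real.log_two_gt_d9]

/-- The logarithm of `(1 + t) / log (2 + t)` is comparable to `log (2 + t)`. -/
theorem half_log_sub_le_log_div {t : ℝ} (ht : 0 ≤ t) :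
    Real.log (2 + t) / 2 - Real.log 2 ≤ Real.log ((1 + t) / Real.log (2 + t)) := by
  have hL : 0 < Real.log (2 + t) := by linarith [half_le_log_two_add ht]
  rw [Real.log_div (by positivity) hL.ne']
  have h1 := log_le_half hL
  have h2 : Real.log (2 + t) ≤ Real.log 2 + Real.log (1 + t) := by
    rw [← Real.log_mul (by norm_num) (by positivity)]
    exact Real.log_le_log (by positivity) (by linarith)
  linarith

/-- `(1 + t) / log (2 + t)` is small compared with any upper bound of `t`, once that bound is
large. -/
theorem exists_forall_div_log_le {η : ℝ} (hη : 0 < η) :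
    ∃ X₀ : ℝ, ∀ X, X₀ ≤ X → ∀ t, 0 ≤ t → t ≤ X → (1 + t) / Real.log (2 + t) ≤ η * X := by
  set t₁ := Real.exp (2 / η) with ht₁
  have ht₁1 : 1 ≤ t₁ := Real.one_le_exp (by positivity)
  refine ⟨2 * (1 + t₁) / η, fun X hX t ht htX => ?_⟩
  have hL := half_le_log_two_add ht
  rw [div_le_iff₀ (by linarith)]
  rw [div_le_iff₀ hη] at hX
  rcases le_total t₁ t with h | h
  · have h1 : 2 / η ≤ Real.log (2 + t) := by
      rw [Real.le_log_iff_exp_le (by positivity)]; linarith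
    rw [div_le_iff₀ hη] at h1
    have h2 : 2 * X ≤ Real.log (2 + t) * η * X :=
      mul_le_mul_of_nonneg_right h1 (by linarith)
    linarith
  · have h3 : X * η * (1 / 2) ≤ X * η * Real.log (2 + t) :=
      mul_le_mul_of_nonneg_left hL (mul_nonneg (by linarith) hη.le)
    linarith

/-- The scale `R = A ((1 + t) / log (2 + t)) ^ (1 / (d - 1))`. With radii allowed to grow like
`k R / N`, the weight of the indices covered by dense cubes and the weight of all indices balance
at this `R`, where `t = #E / (ε N)`; the constant `A` decides in favour of the latter. -/
noncomputable def critScale (d : ℕ) (A t : ℝ) : ℝ :=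
  A * ((1 + t) / Real.log (2 + t)) ^ (1 / ((d : ℝ) - 1))

section critScale

variable {d : ℕ} {A t : ℝ}

theorem critScale_pos (hA : 0 < A) (ht : 0 ≤ t) : 0 < critScale d A t := by
  have hL : 0 < Real.log (2 + t) := by linarith [half_le_log_two_add ht]
  rw [critScale]; positivity

theorem critScale_pow (hd : 2 ≤ d) (ht : 0 ≤ t) :
    critScale d A t ^ (d - 1) = A ^ (d - 1) * ((1 + t) / Real.log (2 + t)) := by
  have hL : 0 < Real.log (2 + t) := by linarith [half_le_log_two_add ht]
  have hcast : (((d - 1 : ℕ)) : ℝ) = (d : ℝ) - 1 := by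
    rw [Nat.cast_sub (by omega)]; simp
  have hd1 : (d : ℝ) - 1 ≠ 0 := by
    rw [← hcast]; exact_mod_cast (by omega : d - 1 ≠ 0)
  rw [critScale, mul_pow, ← Real.rpow_mul_natCast (by positivity), hcast, one_div,
    inv_mul_cancel₀ hd1, Real.rpow_one]

theorem critScale_le_half (hd : 2 ≤ d) (hA : 0 < A) (ht : 0 ≤ t) {N : ℝ} (hN : 0 ≤ N)
    (h : (1 + t) / Real.log (2 + t) ≤ (1 / (2 * A)) ^ (d - 1) * N ^ (d - 1)) :
    critScale d A t ≤ N / 2 := by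
  refine le_of_pow_le_pow_left₀ (by omega : d - 1 ≠ 0) (by positivity) ?_
  rw [critScale_pow hd ht]
  calc _ ≤ A ^ (d - 1) * ((1 / (2 * A)) ^ (d - 1) * N ^ (d - 1)) := by gcongr
    _ = (A * (1 / (2 * A)) * N) ^ (d - 1) := by rw [mul_pow, mul_pow]; ring
    _ = (N / 2) ^ (d - 1) := by congr 1; field_simp

/-- The available weight at the critical scale. -/
theorem critScale_weight_le (hd : 2 ≤ d) (ht : 0 ≤ t) {s₀ N : ℝ} (hs₀ : 1 ≤ s₀) (hN : 0 < N)
    (hA : 160 * d * s₀ ≤ A) (hAN : critScale d A t ≤ N / 2) {K : ℕ} (hK : N ≤ 40 * d * (K + 1)) :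
    N / critScale d A t * (Real.log (2 + t) / (2 * ((d : ℝ) - 1))) ≤
      ∑ k ∈ Finset.Icc 1 K, (s₀ + critScale d A t / N * k)⁻¹ := by
  have hdR : (2 : ℝ) ≤ d := by exact_mod_cast hd
  have hA0 : 0 < A := lt_of_lt_of_le (by positivity) hA
  have hR := critScale_pos (d := d) hA0 ht
  have hL : 0 < Real.log (2 + t) := by linarith [half_le_log_two_add ht]
  set q : ℝ := 1 / ((d : ℝ) - 1) with hq
  have hq0 : 0 ≤ q := by rw [hq]; apply div_nonneg <;> linarith
  have hq1 : q ≤ 1 := by rw [hq, div_le_one (by linarith)]; linarith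
  set Z : ℝ := (1 + t) / Real.log (2 + t) with hZ
  have hZ0 : 0 < Z := by positivity
  have hZq : 0 < Z ^ q := by positivity
  have hRdef : critScale d A t = A * Z ^ q := rfl
  set R := critScale d A t with hRset
  have hlam : 0 < R / N := by positivity
  have hlam1 : R / N ≤ s₀ := by
    rw [div_le_iff₀ hN]; nlinarith
  have hratio : 2 * Z ^ q ≤ (s₀ + R / N * (K + 1)) / (s₀ + R / N) := by
    rw [le_div_iff₀ (by positivity)]
    have h1 : R / N * N ≤ R / N * (40 * d * (K + 1)) := by gcongr
    rw [div_mul_cancel₀ _ hN.ne', hRdef] at h1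
    have h2 : 160 * d * s₀ * Z ^ q ≤ A * Z ^ q := by gcongr
    have h3 : 40 * (d : ℝ) * (4 * s₀ * Z ^ q) ≤ 40 * d * (R / N * (K + 1)) := by
      rw [hRdef]; linarith
    have h4 := le_of_mul_le_mul_left h3 (by positivity)
    have h5 : Z ^ q * (R / N) ≤ Z ^ q * s₀ := by gcongr
    linarith
  have hlog : Real.log (2 + t) * q / 2 ≤
      Real.log ((s₀ + R / N * (K + 1)) / (s₀ + R / N)) := by
    refine le_trans ?_ (Real.log_le_log (by positivity) hratio)
    rw [Real.log_mul (by norm_num) hZq.ne', Real.log_rpow hZ0]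
    have h1 := mul_le_mul_of_nonneg_left (half_log_sub_le_log_div ht) hq0
    have h2 : q * Real.log 2 ≤ 1 * Real.log 2 :=
      mul_le_mul_of_nonneg_right hq1 (Real.log_nonneg (by norm_num))
    linarith
  refine le_trans ?_ (log_div_le_sum_inv (by positivity) hlam K)
  rw [le_div_iff₀ hlam]
  calc _ = Real.log (2 + t) * q / 2 := by
        rw [hq]
        have : (d : ℝ) - 1 ≠ 0 := by linarith
        field_simp
    _ ≤ _ := hlog

/-- At the critical scale the covered weight is at most a twentieth of the available one. -/
theorem critScale_covered_le (hd : 2 ≤ d) (ht : 0 ≤ t) {N C : ℝ} (hN : 0 < N)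
    (hA1 : 1 ≤ A) (hA : 40 * C * ((d : ℝ) - 1) ≤ A) :
    20 * (C / (critScale d A t / N) ^ d * (t * N)) ≤
      N / critScale d A t * (Real.log (2 + t) / (2 * ((d : ℝ) - 1))) * N ^ d := by
  have hdR : (0 : ℝ) < (d : ℝ) - 1 := by
    have : (2 : ℝ) ≤ d := by exact_mod_cast hd
    linarith
  have hR := critScale_pos (d := d) (by linarith : 0 < A) ht
  have hL : 0 < Real.log (2 + t) := by linarith [half_le_log_two_add ht]
  have hpow := critScale_pow (A := A) hd ht
  set R := critScale d A t with hRset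
  have hAp : A ≤ A ^ (d - 1) := le_self_pow₀ hA1 (by omega)
  have hkey : 40 * C * ((d : ℝ) - 1) * t ≤ R ^ (d - 1) * Real.log (2 + t) := by
    rw [hpow, mul_assoc (A ^ (d - 1)), div_mul_cancel₀ _ hL.ne']
    have := mul_le_mul (hA.trans hAp) (by linarith : t ≤ 1 + t) ht (by positivity)
    linarith
  have hRd : R ^ d = R ^ (d - 1) * R := by rw [← pow_succ]; congr 1; omega
  have e1 : 20 * (C / (R / N) ^ d * (t * N)) =
      (40 * C * ((d : ℝ) - 1) * t) * (N ^ d * N / (2 * ((d : ℝ) - 1) * (R ^ (d - 1) * R))) := by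
    rw [div_pow, hRd]
    field_simp
    ring
  have e2 : N / R * (Real.log (2 + t) / (2 * ((d : ℝ) - 1))) * N ^ d =
      (R ^ (d - 1) * Real.log (2 + t)) *
        (N ^ d * N / (2 * ((d : ℝ) - 1) * (R ^ (d - 1) * R))) := by
    field_simp
  rw [e1, e2]
  gcongr

/-- The weight at the critical scale has the order of the claimed number of layers. -/
theorem le_critScale_weight (hd : 2 ≤ d) (hA : 0 < A) (ht : 0 ≤ t) {N : ℝ} (hN : 0 ≤ N) :
    1 / (20 * ((d : ℝ) - 1) * A) * (N / (1 + t ^ (1 / ((d : ℝ) - 1))) *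
      Real.log (2 + t) ^ ((d : ℝ) / ((d : ℝ) - 1))) ≤
      N / critScale d A t * (Real.log (2 + t) / (2 * ((d : ℝ) - 1))) / 10 := by
  have hdR : (1 : ℝ) ≤ (d : ℝ) - 1 := by
    have : (2 : ℝ) ≤ d := by exact_mod_cast hd
    linarith
  have hL : 0 < Real.log (2 + t) := by linarith [half_le_log_two_add ht]
  have hexp : (d : ℝ) / ((d : ℝ) - 1) = 1 + 1 / ((d : ℝ) - 1) := by
    field_simp; ring
  rw [hexp, critScale]
  set q : ℝ := 1 / ((d : ℝ) - 1) with hq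
  have hq0 : 0 ≤ q := by positivity
  have hq1 : q ≤ 1 := by rw [hq, div_le_one (by linarith)]; linarith
  rw [Real.rpow_add hL, Real.rpow_one, Real.div_rpow (by positivity) hL.le]
  have hsub : (1 + t) ^ q ≤ 1 + t ^ q := by
    have := Real.rpow_add_le_add_rpow zero_le_one ht hq0 hq1
    rwa [Real.one_rpow] at this
  have h1t : 0 < (1 + t) ^ q := by positivity
  have htq : 0 ≤ t ^ q := by positivity
  have hLq : 0 < Real.log (2 + t) ^ q := by positivity
  calc _ = (N * Real.log (2 + t) * Real.log (2 + t) ^ q / (20 * ((d : ℝ) - 1) * A)) /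
        (1 + t ^ q) := by field_simp
    _ ≤ (N * Real.log (2 + t) * Real.log (2 + t) ^ q / (20 * ((d : ℝ) - 1) * A)) /
        (1 + t) ^ q := by gcongr
    _ = _ := by field_simp; ring

end critScale

/-! ### The lower bound -/

/-- One layer is always available: large layer cubes are all of `[-M, M]ᵈ`. -/
theorem exists_layerSequence_one {d M : ℕ} {ε r₀ : ℝ} {E : Finset (Fin d → ℤ)}
    (hE : E ⊆ latticeBox d M) (hEc : (E.card : ℝ) ≤ ε * ((M + M : ℕ) : ℝ) ^ d)
    {I : Fin d → ℤ} (hI : I ∈ centralBox d M 0) :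
    ∃ k : Fin 1 → ℕ, IsLayerSequence (M + M) ε r₀ (E : Set (Fin d → ℤ)) I 1 k := by
  refine isLayerSequence_of_separated (S := {0}) (K := 0) (s₀ := ⌈r₀ / 2⌉₊)
    (r := fun _ => ((⌈r₀ / 2⌉₊ + (M + M) : ℕ) : ℝ)) (fun _ _ _ => le_rfl) (Nat.le_ceil _)
    (mem_centralBox.1 hI) (by simp) (fun k _ J hJ _ _ => ⟨_, Nat.le_add_right _ _, le_rfl, ?_⟩)
    (by simp)
  rw [IsSparseAt, boxBall_eq_latticeBox hJ (by omega), Finset.inter_eq_left.2 hE, card_latticeBox]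
  exact_mod_cast hEc

theorem lemma2p1 (d : ℕ) (hd : 2 ≤ d) :
    ∃ c₀ : ℝ, 0 < c₀ ∧ c₀ < 1 ∧ ∃ N₀ : ℕ,
      ∀ r₀ : ℝ, 1 < r₀ → ∃ α : ℝ, 0 < α ∧
        ∀ ε : ℝ, 0 < ε → ∀ N : ℕ, Even N → N₀ < N →
          ∀ E : Set (Fin d → ℤ), E ⊆ basicCubesIn d N →
            (E.ncard : ℝ) / ((basicCubesIn d N).ncard : ℝ) ≤ ε * c₀ →
            ((basicCubesIn d N).ncard : ℝ) / 2 ≤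
              (({I ∈ basicCubesIn d N | ∃ (n : ℕ) (k : Fin n → ℕ),
                IsLayerSequence N ε r₀ E I n k ∧
                α * ((N : ℝ) / (1 + ((E.ncard : ℝ) / (ε * N)) ^ (1 / ((d : ℝ) - 1))) *
                  Real.log (2 + (E.ncard : ℝ) / (ε * N)) ^ ((d : ℝ) / ((d : ℝ) - 1)))
                  ≤ (n : ℝ)}.ncard : ℕ) : ℝ) := by
  classical
  have hdR : (2 : ℝ) ≤ d := by exact_mod_cast hd
  have h17 : (1 : ℝ) ≤ 17 ^ d := one_le_pow₀ (by norm_num)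
  refine ⟨1 / (10 * 17 ^ d), by positivity, ?_, 40 * d, fun r₀ hr₀ => ?_⟩
  · rw [div_lt_one (by positivity)]; linarith
  set s₀ : ℕ := ⌈r₀ / 2⌉₊ with hs₀
  have hs₀1 : 1 ≤ s₀ := Nat.one_le_ceil_iff.2 (by linarith)
  -- `C` bounds the covered weight in `sum_not_isAdmissible_le`; the first term of `A` pays for the
  -- logarithm in `critScale_weight_le`, the second for `critScale_covered_le`
  set C : ℝ := 18 * d * 15 ^ (d - 1) with hC
  set A : ℝ := 160 * d * s₀ + 40 * C * ((d : ℝ) - 1) with hA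
  have hs₀R : (1 : ℝ) ≤ s₀ := by exact_mod_cast hs₀1
  have hA2 : 0 ≤ 40 * C * ((d : ℝ) - 1) := mul_nonneg (by positivity) (by linarith)
  have hA1 : 1 ≤ A := by nlinarith
  have hA0 : 0 < A := by linarith
  obtain ⟨X₀, hX₀⟩ := exists_forall_div_log_le
    (show (0 : ℝ) < (1 / (2 * A)) ^ (d - 1) by positivity)
  set D : ℝ := |X₀| * Real.log (2 + |X₀| ^ (d - 1)) ^ ((d : ℝ) / ((d : ℝ) - 1)) with hD
  have hLX : 0 < Real.log (2 + |X₀| ^ (d - 1)) := by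
    linarith [half_le_log_two_add (show 0 ≤ |X₀| ^ (d - 1) by positivity)]
  have hD0 : 0 ≤ D := by positivity
  have hα0 : 0 < 1 / (20 * ((d : ℝ) - 1) * A) := by
    have : 0 < (d : ℝ) - 1 := by linarith
    positivity
  refine ⟨min (1 / (20 * ((d : ℝ) - 1) * A)) (1 / (D + 1)), lt_min hα0 (by positivity), ?_⟩
  rintro ε hε _ ⟨M, rfl⟩ hNM E hE hEc
  rw [basicCubesIn_eq] at hE hEc ⊢
  obtain ⟨E, rfl⟩ := ((latticeBox d M).finite_toSet.subset hE).exists_finset_coe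
  rw [Finset.coe_subset] at hE
  rw [Set.ncard_coe_finset] at hEc ⊢
  rw [Set.ncard_coe_finset, card_latticeBox] at hEc ⊢
  set N : ℝ := ((M + M : ℕ) : ℝ) with hN
  have hN1 : 1 ≤ N := by rw [hN]; exact_mod_cast (by omega : 1 ≤ M + M)
  have hN0 : 0 < N := by linarith
  rw [Nat.cast_pow, ← hN] at hEc ⊢
  have hNd : 0 < N ^ d := by positivity
  have hEN : 10 * 17 ^ d * (E.card / ε) ≤ N ^ d := by
    rw [div_le_iff₀ hNd] at hEc
    have : (E.card : ℝ) / ε ≤ 1 / (10 * 17 ^ d) * N ^ d := by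
      rw [div_le_iff₀ hε]; linarith
    calc _ ≤ 10 * 17 ^ d * (1 / (10 * 17 ^ d) * N ^ d) := by gcongr
      _ = _ := by field_simp
  have hEε : (E.card : ℝ) / ε ≤ N ^ d := by
    have : 0 ≤ (E.card : ℝ) / ε := by positivity
    nlinarith
  set t : ℝ := E.card / (ε * N) with ht
  have ht0 : 0 ≤ t := by positivity
  have htN : t * N = E.card / ε := by rw [ht]; field_simp
  have htX : t ≤ N ^ (d - 1) := by
    refine le_of_mul_le_mul_right ?_ hN0
    rw [htN, ← pow_succ, show d - 1 + 1 = d by omega]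
    exact hEε
  have hL : 0 < Real.log (2 + t) := by linarith [half_le_log_two_add ht0]
  set Φ : ℝ := N / (1 + t ^ (1 / ((d : ℝ) - 1))) *
    Real.log (2 + t) ^ ((d : ℝ) / ((d : ℝ) - 1)) with hΦ
  have hΦ0 : 0 ≤ Φ := by positivity
  -- It suffices to find the cubes in a finite set
  suffices h : ∃ F ⊆ latticeBox d M, N ^ d / 2 ≤ F.card ∧ ∀ I ∈ F, ∃ (n : ℕ) (k : Fin n → ℕ),
      IsLayerSequence (M + M) ε r₀ (E : Set (Fin d → ℤ)) I n k ∧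
      min (1 / (20 * ((d : ℝ) - 1) * A)) (1 / (D + 1)) * Φ ≤ n by
    obtain ⟨F, hF, hcard, h⟩ := h
    refine hcard.trans ?_
    rw [← Set.ncard_coe_finset]
    exact Nat.cast_le.2 (Set.ncard_le_ncard (fun I hI => ⟨hF hI, h I hI⟩)
      ((latticeBox d M).finite_toSet.subset fun I hI => hI.1))
  set K : ℕ := (M + M) / (40 * d)
  have hK1 : 40 * d * K ≤ M + M := Nat.mul_div_le _ _
  have hK2 : M + M < 40 * d * (K + 1) := by
    exact Nat.lt_mul_div_succ _ (by omega)
  have hK3 : 10 * d * (2 * K + 2) ≤ M + M := by nlinarith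
  rcases le_or_gt X₀ N with hX | hX
  · have hXN : X₀ ≤ N ^ (d - 1) := hX.trans (le_self_pow₀ hN1 (by omega))
    have hRN := critScale_le_half hd hA0 ht0 hN0.le (hX₀ _ hXN t ht0 htX)
    have hR := critScale_pos (d := d) hA0 ht0
    have hd1 : 0 < (d : ℝ) - 1 := by linarith
    refine ⟨_, Finset.filter_subset _ _, exists_many_layerSequences
      (T := N / critScale d A t * (Real.log (2 + t) / (2 * ((d : ℝ) - 1))))
      (lam := critScale d A t / N) hd hs₀1 hε (Nat.le_ceil _) (by positivity) ?_ hK3 hE hEN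
      (by positivity) ?_ ?_, fun I hI => ?_⟩
    · rw [div_le_iff₀ hN0]; linarith
    · refine critScale_weight_le hd ht0 hs₀R hN0 (by linarith) hRN ?_
      rw [hN]; exact_mod_cast hK2.le
    · rw [← htN]
      exact critScale_covered_le hd ht0 hN0 hA1 (by
        have : (0 : ℝ) ≤ 160 * d * s₀ := by positivity
        linarith)
    · obtain ⟨n, k, hk, hn⟩ := (Finset.mem_filter.1 hI).2
      refine ⟨n, k, hk, le_trans ?_ ((le_critScale_weight hd hA0 ht0 hN0.le).trans hn)⟩
      exact mul_le_mul_of_nonneg_right (min_le_left _ _) hΦ0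
  · refine ⟨centralBox d M 0, centralBox_subset d M 0, ?_, fun I hI => ?_⟩
    · have := le_card_centralBox (d := d) (M := M) (K := 0) (by omega) (by omega)
      rw [← hN] at this
      linarith
    · obtain ⟨k, hk⟩ := exists_layerSequence_one (r₀ := r₀) (ε := ε) hE (by
        rw [div_le_iff₀ hε] at hEε; rw [← hN]; linarith) hI
      refine ⟨1, k, hk, ?_⟩
      -- For bounded `N` the required number of layers is bounded
      have hΦD : Φ ≤ D := by
        have h1 : N ≤ |X₀| := hX.le.trans (le_abs_self _)
        have h2 : t ≤ |X₀| ^ (d - 1) := htX.trans (pow_le_pow_left₀ hN0.le h1 _)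
        have htq : 0 ≤ t ^ (1 / ((d : ℝ) - 1)) := by positivity
        have h3 : N / (1 + t ^ (1 / ((d : ℝ) - 1))) ≤ |X₀| :=
          (div_le_self hN0.le (by linarith)).trans h1
        have h4 : 0 ≤ (d : ℝ) / ((d : ℝ) - 1) := div_nonneg (by linarith) (by linarith)
        rw [hΦ, hD]
        gcongr
      calc _ ≤ 1 / (D + 1) * D := by
            gcongr
            exact min_le_right _ _
        _ ≤ ((1 : ℕ) : ℝ) := by
            rw [one_div, inv_mul_le_iff₀ (by positivity)]
            push_cast; linarith
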